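/- Let $g:\mathbb R^n\to(-\infty,+\infty]$ be a convex function with $0<Z:=\int_{\mathbb R^n}e^{-g(x)}\,dx<\infty$, so that $p(x)=e^{-g(x)}/Z$ is a log-concave (posterior) probability density on $\mathbb R^n$. Let $\hat x_{\mathrm{MAP}}\in\operatorname{argmin}_{x\in\mathbb R^n} g(x)$ be a maximum-a-posteriori estimator, let $\alpha\in(0,1)$, and let $\gamma_\alpha\in\mathbb R$ be the threshold of the highest-posterior-density region of level $1-\alpha$, i.e. a real number with $\int_{\{x\,:\,g(x)\le\gamma_\alpha\}}p(x)\,dx=1-\alpha$. Put $$\tau_\alpha=\sqrt{\frac{16\log(3/\alpha)}{n}},\qquad \tilde\gamma_\alpha=g(\hat x_{\mathrm{MAP}})+n(\tau_\alpha+1),\qquad \eta_\alpha=\sqrt{16\log(3/\alpha)}+\sqrt{1/\alpha}.$$ Then $\eta_\alpha>0$ depends only on $\alpha$ (not on the distribution $p$ and not on $n$), and $$\tilde\gamma_\alpha-\gamma_\alpha\le\eta_\alpha\sqrt n+n .$$ If moreover $\alpha>4e^{-n/3}$, then also $0\le\tilde\gamma_\alpha-\gamma_\alpha$. In particular, for every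 $\alpha\in(4e^{-n/3},1)$, $$0\le\tilde\gamma_\alpha-\gamma_\alpha\le\eta_\alpha\sqrt n+n .$$ -/

import Mathlib

open MeasureTheory
open scoped ENNReal

noncomputable section

/-- Convexity of an extended-real-valued function that does not take the value `-∞`
(with the convention `0 * ∞ = 0`). -/
def ConvexEReal {n : ℕ} (g : EuclideanSpace ℝ (Fin n) → EReal) : Prop :=
  ∀ x y : EuclideanSpace ℝ (Fin n), ∀ a b : ℝ, 0 ≤ a → 0 ≤ b → a + b = 1 →
    g (a • x + b • y) ≤ (a : EReal) * g x + (b : EReal) * g y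

/-- The normalising constant `Z = ∫ exp (-g x) dx`, with `exp (-∞) = 0`. -/
def normalisingConstant {n : ℕ} (g : EuclideanSpace ℝ (Fin n) → EReal) : ℝ≥0∞ :=
  ∫⁻ x, EReal.exp (-g x)

/-- The density `p(x) = exp (-g x) / Z`. -/
def posteriorDensity {n : ℕ} (g : EuclideanSpace ℝ (Fin n) → EReal)
    (x : EuclideanSpace ℝ (Fin n)) : ℝ≥0∞ :=
  EReal.exp (-g x) / normalisingConstant g

/-- `p = exp (-g) / Z` is a log-concave probability density on `ℝⁿ`: the potential `g` is convex
with values in `(-∞, +∞]` (the value `+∞` encodes convex constraints), and `0 < Z < ∞`. -/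
structure IsLogConcavePosterior {n : ℕ} (g : EuclideanSpace ℝ (Fin n) → EReal) : Prop where
  ne_bot : ∀ x, g x ≠ ⊥
  convex : ConvexEReal g
  normalisingConstant_ne_zero : normalisingConstant g ≠ 0
  normalisingConstant_ne_top : normalisingConstant g ≠ ⊤

/-- `x` is a maximum-a-posteriori estimator: a global minimiser of `g`. -/
def IsMAP {n : ℕ} (g : EuclideanSpace ℝ (Fin n) → EReal)
    (x : EuclideanSpace ℝ (Fin n)) : Prop :=
  ∀ z, g x ≤ g z

/-- The sublevel set `{x | g x ≤ γ}`. -/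
def hpdRegion {n : ℕ} (g : EuclideanSpace ℝ (Fin n) → EReal) (γ : ℝ) :
    Set (EuclideanSpace ℝ (Fin n)) :=
  {x | g x ≤ (γ : EReal)}

/-- `γ` is the threshold of the highest-posterior-density region of level `1 - α`:
the posterior probability of `{x | g x ≤ γ}` is `1 - α`. -/
def IsHPDThreshold {n : ℕ} (g : EuclideanSpace ℝ (Fin n) → EReal) (α γ : ℝ) : Prop :=
  ∫⁻ x in hpdRegion g γ, posteriorDensity g x = ENNReal.ofReal (1 - α)

/-- `τ_α = √(16 log (3 / α) / n)`. -/
def tauConst (n : ℕ) (α : ℝ) : ℝ := Real.sqrt (16 * Real.log (3 / α) / n)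

/-- `η_α = √(16 log (3 / α)) + √(1 / α)`. -/
def etaConst (α : ℝ) : ℝ := Real.sqrt (16 * Real.log (3 / α)) + Real.sqrt (1 / α)

/-- The surrogate threshold `g x + n (τ_α + 1)`, to be used with a MAP estimator `x`. -/
def surrogateThreshold {n : ℕ} (g : EuclideanSpace ℝ (Fin n) → EReal)
    (x : EuclideanSpace ℝ (Fin n)) (α : ℝ) : EReal :=
  g x + ((n * (tauConst n α + 1) : ℝ) : EReal)

end

/-!
Let `m = g xMAP`, a real number, and let `f = g - m ≥ 0`.

*Upper bound.* The region `{g ≤ γ}` has probability `1 - α > 0`, so it is nonempty and `m ≤ γ`.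
As `n τ_α = √n √(16 log (3 / α))`, the surrogate threshold exceeds `m` by
`n + √n √(16 log (3 / α)) ≤ n + η_α √n`, which is all the bound asks for.

*Lower bound.* This is a tail estimate for `f`, obtained from an exponential moment. Convexity gives
`f (x₀ + s (y - x₀)) ≤ s f y` for `x₀ = xMAP` and `0 ≤ s ≤ 1`, so a dilation with centre `x₀` shows
`∫ exp (-s f) ≤ s⁻ⁿ ∫ exp (-f)` (`lintegral_exp_neg_interpolate_le`), that is,
`𝔼 exp ((1 - s) f) ≤ s⁻ⁿ`. Chernoff's bound with `s = 1 / (1 + τ)` yields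
`ℙ (f > n (1 + τ)) ≤ exp (-n (τ - log (1 + τ)))` (`setLIntegral_exp_neg_superlevel_le`), and
`τ ^ 2 / 16 ≤ τ - log (1 + τ)` for `0 ≤ τ ≤ 8` (`sq_div_le_sub_log_one_add`). For `τ = τ_α` the
exponent `n τ ^ 2 / 16` is `log (3 / α)`, and `α > 4 exp (-n / 3)` forces `τ ≤ 8`. If the surrogate
threshold were below `γ`, then `α = ℙ (g > γ) ≤ α / 3`, which is absurd.

Nothing forces `g` to be Borel measurable, since the boundary values of a convex function are almost
arbitrary. The change of variables is along a homeomorphism and needs no measurability, and the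
sublevel sets of `g`, being convex, are null measurable (`nullMeasurableSet_hpdRegion`).
-/

/-! ### An elementary inequality for the logarithm -/

lemma sq_div_le_sub_log_one_add {t : ℝ} (h0 : 0 ≤ t) (h8 : t ≤ 8) :
    t ^ 2 / 16 ≤ t - Real.log (1 + t) := by
  -- With `w = √(1 + t)`, the bound `log w ≤ w - 1` reduces the claim to
  -- `(w ^ 2 - 1) ^ 2 ≤ 16 (w - 1) ^ 2`, true because `w ≤ 3`.
  obtain ⟨w, hw1, hw3, hw⟩ : ∃ w : ℝ, 1 ≤ w ∧ w ≤ 3 ∧ w ^ 2 = 1 + t :=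
    ⟨Real.sqrt (1 + t), Real.one_le_sqrt.2 (by linarith),
      Real.sqrt_le_iff.2 ⟨by norm_num, by linarith⟩, Real.sq_sqrt (by linarith)⟩
  have hlog : Real.log w ≤ w - 1 := Real.log_le_sub_one_of_pos (by linarith)
  have ht : t = w ^ 2 - 1 := by linarith
  rw [← hw, Real.log_pow, ht]
  push_cast
  have h4 : (w + 1) ^ 2 ≤ 16 := by nlinarith
  nlinarith [mul_le_mul_of_nonneg_left h4 (sq_nonneg (w - 1))]

/-! ### Dilations and exponential moments -/

/-- Change of variables for the dilation by the factor `s` with centre `x₀`, without any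
measurability assumption on the integrand. -/
lemma lintegral_comp_dilation {n : ℕ} (F : EuclideanSpace ℝ (Fin n) → ℝ≥0∞)
    (x₀ : EuclideanSpace ℝ (Fin n)) {s : ℝ} (hs : 0 < s) :
    ∫⁻ y, F (s • y + (1 - s) • x₀) = ENNReal.ofReal ((s ^ n)⁻¹) * ∫⁻ x, F x := by
  have h := (Homeomorph.smulOfNeZero (α := EuclideanSpace ℝ (Fin n)) s hs.ne').measurableEmbedding
    |>.lintegral_map (μ := volume) (fun z => F (z + (1 - s) • x₀))
  simp only [Homeomorph.smulOfNeZero_apply] at h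
  rw [← h]
  have hmap : Measure.map (fun y : EuclideanSpace ℝ (Fin n) => s • y) volume =
      ENNReal.ofReal ((s ^ n)⁻¹) • volume := by
    rw [Measure.map_addHaar_smul volume hs.ne', finrank_euclideanSpace_fin,
      abs_of_pos (by positivity)]
  change ∫⁻ a, F (a + (1 - s) • x₀) ∂(Measure.map (fun y => s • y) volume) = _
  rw [hmap, lintegral_smul_measure, lintegral_add_right_eq_self F, smul_eq_mul]

/-- With `f = g - m` and `m = g x₀`, this says `∫ exp (-s f) ≤ s⁻ⁿ ∫ exp (-f)`: convexity bounds
the left integrand by `exp (-f)` composed with a dilation centred at `x₀`. -/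
lemma lintegral_exp_neg_interpolate_le {n : ℕ} {g : EuclideanSpace ℝ (Fin n) → EReal}
    (hg : ConvexEReal g) {x₀ : EuclideanSpace ℝ (Fin n)} {m : ℝ} (hm : g x₀ = m)
    {s : ℝ} (hs : 0 < s) (hs1 : s ≤ 1) :
    ∫⁻ y, EReal.exp (-((s : EReal) * g y + ((1 - s : ℝ) : EReal) * m)) ≤
      ENNReal.ofReal ((s ^ n)⁻¹) * normalisingConstant g := by
  rw [normalisingConstant, ← lintegral_comp_dilation (fun x => EReal.exp (-g x)) x₀ hs]
  refine lintegral_mono fun y => EReal.exp_monotone (EReal.neg_le_neg_iff.2 ?_)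
  have h := hg y x₀ s (1 - s) hs.le (by linarith) (by ring)
  rwa [hm] at h

lemma exp_neg_le_of_lt {u : EReal} {γ m s : ℝ} (hu : (γ : EReal) < u) (hs1 : s ≤ 1) :
    EReal.exp (-u) ≤ ENNReal.ofReal (Real.exp (-((1 - s) * (γ - m)))) *
      EReal.exp (-((s : EReal) * u + ((1 - s : ℝ) : EReal) * m)) := by
  induction u with
  | bot => simp at hu
  | top => simp
  | coe a =>
    have ha : γ < a := EReal.coe_lt_coe_iff.1 hu
    norm_cast
    rw [EReal.exp_coe, EReal.exp_coe, ← ENNReal.ofReal_mul (Real.exp_nonneg _), ← Real.exp_add]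
    refine ENNReal.ofReal_le_ofReal (Real.exp_le_exp.2 ?_)
    nlinarith

/-! ### The tail estimate -/

lemma convex_hpdRegion {n : ℕ} {g : EuclideanSpace ℝ (Fin n) → EReal} (hg : ConvexEReal g)
    (γ : ℝ) : Convex ℝ (hpdRegion g γ) := by
  intro x hx y hy a b ha hb hab
  have hx' : g x ≤ γ := hx
  have hy' : g y ≤ γ := hy
  calc g (a • x + b • y) ≤ (a : EReal) * g x + (b : EReal) * g y := hg x y a b ha hb hab
    _ ≤ (a : EReal) * γ + (b : EReal) * γ :=
        add_le_add (mul_le_mul_of_nonneg_left hx' (EReal.coe_nonneg.2 ha))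
          (mul_le_mul_of_nonneg_left hy' (EReal.coe_nonneg.2 hb))
    _ = γ := by norm_cast; rw [← add_mul, hab, one_mul]

lemma nullMeasurableSet_hpdRegion {n : ℕ} {g : EuclideanSpace ℝ (Fin n) → EReal}
    (hg : ConvexEReal g) (γ : ℝ) : NullMeasurableSet (hpdRegion g γ) :=
  (convex_hpdRegion hg γ).nullMeasurableSet volume

/-- Chernoff's bound: under the density proportional to `exp (-g)`, the probability of `{γ < g}` is
at most `exp (-n (τ - log (1 + τ)))` as soon as `γ ≥ g x₀ + n (1 + τ)`. -/
lemma setLIntegral_exp_neg_superlevel_le {n : ℕ} {g : EuclideanSpace ℝ (Fin n) → EReal}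
    (hg : ConvexEReal g) {x₀ : EuclideanSpace ℝ (Fin n)} {m : ℝ} (hm : g x₀ = m)
    {τ γ : ℝ} (hτ : 0 ≤ τ) (hγ : m + n * (τ + 1) ≤ γ) :
    ∫⁻ x in (hpdRegion g γ)ᶜ, EReal.exp (-g x) ≤
      ENNReal.ofReal (Real.exp (-(n * (τ - Real.log (1 + τ))))) * normalisingConstant g := by
  have hτ1 : 0 < 1 + τ := by linarith
  -- This `s` minimises the Chernoff bound `s⁻ⁿ exp (-(1 - s) n (1 + τ))`.
  set s : ℝ := (1 + τ)⁻¹ with hs_def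
  have hs : 0 < s := by positivity
  have hs1 : s ≤ 1 := inv_le_one_of_one_le₀ (by linarith)
  have hsτ : s * (1 + τ) = 1 := inv_mul_cancel₀ hτ1.ne'
  calc ∫⁻ x in (hpdRegion g γ)ᶜ, EReal.exp (-g x)
      ≤ ∫⁻ x in (hpdRegion g γ)ᶜ, ENNReal.ofReal (Real.exp (-((1 - s) * (γ - m)))) *
          EReal.exp (-((s : EReal) * g x + ((1 - s : ℝ) : EReal) * m)) := by
        refine lintegral_mono_ae ?_
        filter_upwards [ae_restrict_mem₀ (nullMeasurableSet_hpdRegion hg γ).compl] with x hx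
        exact exp_neg_le_of_lt (not_le.1 hx) hs1
    _ ≤ ENNReal.ofReal (Real.exp (-((1 - s) * (γ - m)))) *
          ∫⁻ x, EReal.exp (-((s : EReal) * g x + ((1 - s : ℝ) : EReal) * m)) := by
        rw [lintegral_const_mul' _ _ ENNReal.ofReal_ne_top]
        gcongr
        exact Measure.restrict_le_self
    _ ≤ ENNReal.ofReal (Real.exp (-((1 - s) * (γ - m)))) *
          (ENNReal.ofReal ((s ^ n)⁻¹) * normalisingConstant g) := by
        gcongr
        exact lintegral_exp_neg_interpolate_le hg hm hs hs1
    _ ≤ _ := by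
        rw [← mul_assoc, ← ENNReal.ofReal_mul (Real.exp_nonneg _)]
        gcongr
        have hpow : (s ^ n)⁻¹ = Real.exp (n * Real.log (1 + τ)) := by
          rw [mul_comm, Real.exp_mul, Real.exp_log hτ1, Real.rpow_natCast, hs_def, inv_pow, inv_inv]
        rw [hpow, ← Real.exp_add]
        refine Real.exp_le_exp.2 ?_
        have h1 : (1 - s) * (n * (τ + 1)) ≤ (1 - s) * (γ - m) :=
          mul_le_mul_of_nonneg_left (by linarith) (by linarith)
        have h2 : (1 - s) * (n * (τ + 1)) = n * τ := by linear_combination (-(n : ℝ)) * hsτ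
        linarith

/-! ### Comparison of the thresholds -/

lemma setLIntegral_posteriorDensity {n : ℕ} {g : EuclideanSpace ℝ (Fin n) → EReal}
    (hg : IsLogConcavePosterior g) (s : Set (EuclideanSpace ℝ (Fin n))) :
    ∫⁻ x in s, posteriorDensity g x =
      (∫⁻ x in s, EReal.exp (-g x)) * (normalisingConstant g)⁻¹ := by
  simp only [posteriorDensity, div_eq_mul_inv]
  exact lintegral_mul_const' _ _ (ENNReal.inv_ne_top.2 hg.normalisingConstant_ne_zero)

lemma ofReal_le_setLIntegral_compl_hpdRegion {n : ℕ} {g : EuclideanSpace ℝ (Fin n) → EReal}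
    (hg : IsLogConcavePosterior g) {α γ : ℝ} (hα₁ : α ≤ 1) (hγ : IsHPDThreshold g α γ) :
    ENNReal.ofReal α ≤ ∫⁻ x in (hpdRegion g γ)ᶜ, posteriorDensity g x := by
  have htotal : ∫⁻ x, posteriorDensity g x = 1 := by
    rw [← setLIntegral_univ, setLIntegral_posteriorDensity hg, setLIntegral_univ]
    exact ENNReal.mul_inv_cancel hg.normalisingConstant_ne_zero hg.normalisingConstant_ne_top
  have hsplit := lintegral_union_le (μ := volume) (posteriorDensity g) (hpdRegion g γ)
    (hpdRegion g γ)ᶜ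
  rw [Set.union_compl_self, setLIntegral_univ, htotal, hγ] at hsplit
  calc ENNReal.ofReal α = 1 - ENNReal.ofReal (1 - α) := by
        rw [← ENNReal.ofReal_one, ← ENNReal.ofReal_sub _ (by linarith), sub_sub_cancel]
    _ ≤ _ := tsub_le_iff_left.2 hsplit

lemma le_of_isHPDThreshold {n : ℕ} {g : EuclideanSpace ℝ (Fin n) → EReal}
    {x : EuclideanSpace ℝ (Fin n)} (hx : IsMAP g x) {α γ : ℝ} (hα₁ : α < 1)
    (hγ : IsHPDThreshold g α γ) : g x ≤ γ := by
  by_contra h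
  have hempty : hpdRegion g γ = ∅ :=
    Set.eq_empty_of_forall_notMem fun z hz => h ((hx z).trans hz)
  rw [IsHPDThreshold, hempty, setLIntegral_empty, eq_comm, ENNReal.ofReal_eq_zero] at hγ
  linarith

lemma le_surrogateThreshold {n : ℕ} {g : EuclideanSpace ℝ (Fin n) → EReal}
    (hg : IsLogConcavePosterior g) {x₀ : EuclideanSpace ℝ (Fin n)} {m : ℝ} (hm : g x₀ = m)
    {α γ : ℝ} (hα₁ : α < 1) (hγ : IsHPDThreshold g α γ)
    (hα : 4 * Real.exp (-(n : ℝ) / 3) < α) :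
    γ ≤ m + n * (tauConst n α + 1) := by
  by_contra! hlt
  have hα₀ : 0 < α := lt_trans (by positivity) hα
  have hL0 : 0 < Real.log (3 / α) := Real.log_pos (by rw [lt_div_iff₀ hα₀]; linarith)
  have hLn : Real.log (3 / α) < n / 3 := by
    rw [Real.log_lt_iff_lt_exp (by positivity), div_lt_iff₀ hα₀]
    have hexp : Real.exp (n / 3) * Real.exp (-(n : ℝ) / 3) = 1 := by
      rw [← Real.exp_add, neg_div, add_neg_cancel, Real.exp_zero]
    nlinarith [Real.exp_pos ((n : ℝ) / 3)]
  have hn : (0 : ℝ) < n := by linarith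
  have hτ0 : 0 ≤ tauConst n α := Real.sqrt_nonneg _
  have hτsq : n * (tauConst n α ^ 2 / 16) = Real.log (3 / α) := by
    rw [tauConst, Real.sq_sqrt (by positivity)]
    field_simp
  have hτ8 : tauConst n α ≤ 8 := by
    refine Real.sqrt_le_iff.2 ⟨by norm_num, ?_⟩
    rw [div_le_iff₀ hn]
    linarith
  have hexponent : Real.exp (-(n * (tauConst n α - Real.log (1 + tauConst n α)))) ≤ α / 3 := by
    have h := mul_le_mul_of_nonneg_left (sq_div_le_sub_log_one_add hτ0 hτ8) hn.le
    calc _ ≤ Real.exp (-Real.log (3 / α)) := Real.exp_le_exp.2 (by linarith)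
      _ = α / 3 := by rw [Real.exp_neg, Real.exp_log (by positivity), inv_div]
  have htail : ENNReal.ofReal α ≤ ENNReal.ofReal (α / 3) := by
    calc ENNReal.ofReal α ≤ _ := ofReal_le_setLIntegral_compl_hpdRegion hg hα₁.le hγ
      _ = _ := setLIntegral_posteriorDensity hg _
      _ ≤ ENNReal.ofReal (α / 3) * normalisingConstant g * (normalisingConstant g)⁻¹ := by
          gcongr
          refine (setLIntegral_exp_neg_superlevel_le hg.convex hm hτ0 hlt.le).trans ?_
          gcongr
      _ = ENNReal.ofReal (α / 3) := by
          rw [mul_assoc, ENNReal.mul_inv_cancel hg.normalisingConstant_ne_zero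
            hg.normalisingConstant_ne_top, mul_one]
  rw [ENNReal.ofReal_le_ofReal_iff (by positivity)] at htail
  linarith

lemma natCast_mul_tauConst (n : ℕ) (α : ℝ) :
    n * tauConst n α = Real.sqrt (16 * Real.log (3 / α)) * Real.sqrt n := by
  rw [tauConst, Real.sqrt_div' _ n.cast_nonneg, mul_div_left_comm, Real.div_sqrt]

theorem theorem2 (n : ℕ) (g : EuclideanSpace ℝ (Fin n) → EReal)
    (hg : IsLogConcavePosterior g)
    (xMAP : EuclideanSpace ℝ (Fin n)) (hMAP : IsMAP g xMAP)
    (α : ℝ) (hα₀ : 0 < α) (hα₁ : α < 1)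
    (γ : ℝ) (hγ : IsHPDThreshold g α γ) :
    0 < etaConst α ∧
    (4 * Real.exp (-(n : ℝ) / 3) < α →
      0 ≤ surrogateThreshold g xMAP α - (γ : EReal)) ∧
    surrogateThreshold g xMAP α - (γ : EReal) ≤
      ((etaConst α * Real.sqrt n + n : ℝ) : EReal) := by
  have hle : g xMAP ≤ γ := le_of_isHPDThreshold hMAP hα₁ hγ
  obtain ⟨m, hm⟩ : ∃ m : ℝ, g xMAP = m :=
    ⟨(g xMAP).toReal, (EReal.coe_toReal (ne_top_of_le_ne_top (EReal.coe_ne_top γ) hle)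
      (hg.ne_bot xMAP)).symm⟩
  have hinv : 0 < Real.sqrt (1 / α) := Real.sqrt_pos.2 (by positivity)
  refine ⟨add_pos_of_nonneg_of_pos (Real.sqrt_nonneg _) hinv, fun hα => ?_, ?_⟩
  · rw [surrogateThreshold, hm]
    exact_mod_cast sub_nonneg.2 (le_surrogateThreshold hg hm hα₁ hγ hα)
  · rw [hm, EReal.coe_le_coe_iff] at hle
    rw [surrogateThreshold, hm, ← EReal.coe_add, ← EReal.coe_sub, EReal.coe_le_coe_iff, etaConst,
      mul_add, natCast_mul_tauConst]
    have h : 0 ≤ Real.sqrt (1 / α) * Real.sqrt n := by positivity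
    linarith
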